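/- For a group $G$ let $\mathbb ZG$ be its integral group ring, $\Delta(G)$ the augmentation ideal of $\mathbb ZG$, and $\mathcal V(\mathbb ZG)$ the group of units of $\mathbb ZG$ of augmentation one. Put $\mathcal V_n(\mathbb ZG)=\mathcal V(\mathbb ZG)\cap(1+\Delta^n(G))$ for $n\ge 1$ and $\mathcal V_\omega(\mathbb ZG)=\bigcap_{n\ge 1}\mathcal V_n(\mathbb ZG)$. For a prime $p$, an element $h$ of a group $H$ has infinite $p$-height in $H$ if for all natural numbers $i,j$ there are $x\in H$ and $y\in\gamma_j(H)$ (the $j$-th term of the lower central series, $\gamma_1(H)=H$) with $x^{p^i}=hy$. The elements of infinite $p$-height in $H$ form a subgroup, denoted $H(p)$. Theorem. Let $G$ be a nilpotent group with $\mathcal V_\omega(\mathbb ZG)=\{1\}$, and let $T$ be its torsion subgroup. Then at least one of the following holds: (i) $T=\{1\}$; (ii) the order of every element of $T$ is of the form $2^a3^b$, and $T$ has exponent (exactly) $6$; (iii) for some prime $p$, $T$ is a $p$-group, $T(p)\neq T$, and $T(p)$ is an abelian $p$-group of exponent at most $4$. In particular, if moreover $T$ has no element of order $2$ or $3$, then either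 $G$ is torsion-free, or for some prime $p$ the group $T$ is a $p$-group in which no element other than $1$ has infinite $p$-height in $T$. -/

import Mathlib

namespace GroupRingUnits

open Subgroup
open scoped commutatorElement

/-! ### The filtration of the normalized unit group of the integral group ring -/

/-- The augmentation map of the integral group ring `ℤG`, sending every `g ∈ G` to `1`. -/
noncomputable def augmentation (G : Type*) [Group G] : MonoidAlgebra ℤ G →ₐ[ℤ] ℤ :=
  MonoidAlgebra.lift ℤ ℤ G 1

/-- The augmentation ideal `Δ(G)` of `ℤG`. -/
noncomputable def augmentationIdeal (G : Type*) [Group G] : Ideal (MonoidAlgebra ℤ G) :=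
  RingHom.ker (augmentation G)

/-- The group `𝒱(ℤG)` of normalized units: the units of `ℤG` of augmentation one. -/
noncomputable def normalizedUnits (G : Type*) [Group G] : Subgroup (MonoidAlgebra ℤ G)ˣ :=
  (Units.map (augmentation G : MonoidAlgebra ℤ G →* ℤ)).ker

/-- `𝒱_n(ℤG) = 𝒱(ℤG) ∩ (1 + Δⁿ(G))`. -/
noncomputable def unitFiltration (G : Type*) [Group G] (n : ℕ) :
    Subgroup (MonoidAlgebra ℤ G)ˣ where
  carrier := {u | u ∈ normalizedUnits G ∧ (u : MonoidAlgebra ℤ G) - 1 ∈ augmentationIdeal G ^ n}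
  one_mem' := ⟨one_mem _, by simp⟩
  mul_mem' := by
    rintro u v ⟨hu, hu'⟩ ⟨hv, hv'⟩
    refine ⟨mul_mem hu hv, ?_⟩
    have h : ((u * v : (MonoidAlgebra ℤ G)ˣ) : MonoidAlgebra ℤ G) - 1
        = (u : MonoidAlgebra ℤ G) * ((v : MonoidAlgebra ℤ G) - 1) + (u - 1) := by
      push_cast; noncomm_ring
    rw [h]
    exact add_mem (Ideal.mul_mem_left _ _ hv') hu'
  inv_mem' := by
    rintro u ⟨hu, hu'⟩
    refine ⟨inv_mem hu, ?_⟩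
    have h : ((u⁻¹ : (MonoidAlgebra ℤ G)ˣ) : MonoidAlgebra ℤ G) - 1
        = -((u⁻¹ : (MonoidAlgebra ℤ G)ˣ) : MonoidAlgebra ℤ G) * ((u : MonoidAlgebra ℤ G) - 1) := by
      rw [mul_sub, neg_mul, Units.inv_mul]; noncomm_ring
    rw [h]
    exact Ideal.mul_mem_left _ _ hu'

/-- The `Δ`-adic residue `𝒱_ω(ℤG) = ⋂_{n ≥ 1} 𝒱_n(ℤG)`. -/
noncomputable def deltaAdicResidue (G : Type*) [Group G] : Subgroup (MonoidAlgebra ℤ G)ˣ :=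
  ⨅ n : ℕ, ⨅ _ : 1 ≤ n, unitFiltration G n

/-! ### Facts on nilpotent groups: the torsion elements, and the elements of infinite `p`-height,
form subgroups -/

/-- In a nilpotent group of class at most `c + 2`, the subgroup generated by one element and the
commutator subgroup has class at most `c + 1`. -/
theorem lcs_zpowers_sup_commutator {Q : Type*} [Group Q] (g : Q) (n : ℕ) :
    (zpowers g ⊔ commutator Q).lowerCentralSeries (n + 1)
      ≤ (⊤ : Subgroup Q).lowerCentralSeries (n + 2) := by
  induction n with
  | zero =>
    set L := (⊤ : Subgroup Q).lowerCentralSeries 2 with hL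
    let π := QuotientGroup.mk' L
    have hcomm : ∀ a b : Q, ⁅a, b⁆ ∈ L ↔ π a * π b = π b * π a := by
      intro a b
      rw [← commutatorElement_eq_one_iff_mul_comm, ← map_commutatorElement]
      exact (QuotientGroup.eq_one_iff _).symm
    have hC : ∀ h : Q, commutator Q ≤ (centralizer {π h}).comap π := by
      intro h u hu
      rw [mem_comap, mem_centralizer_singleton_iff, ← hcomm]
      exact commutator_mem_commutator (show u ∈ (⊤ : Subgroup Q).lowerCentralSeries 1 from hu)
        (mem_top h)
    have h1 : zpowers g ⊔ commutator Q ≤ (centralizer {π g}).comap π := by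
      refine sup_le ?_ (hC g)
      rw [zpowers_le, mem_comap, mem_centralizer_singleton_iff]
    refine commutator_le.2 fun h hh k hk => ?_
    have h2 : zpowers g ⊔ commutator Q ≤ (centralizer {π h}).comap π := by
      refine sup_le ?_ (hC h)
      have := h1 hh
      rw [mem_comap, mem_centralizer_singleton_iff] at this
      rw [zpowers_le, mem_comap, mem_centralizer_singleton_iff]
      exact this.symm
    have := h2 hk
    rw [mem_comap, mem_centralizer_singleton_iff] at this
    exact (hcomm h k).2 this.symm
  | succ n ih => exact commutator_mono ih le_top

theorem lcs_zpowers_sup_commutator_eq_bot {Q : Type*} [Group Q] (g : Q) (c : ℕ)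
    (h : (⊤ : Subgroup Q).lowerCentralSeries (c + 2) = ⊥) :
    (⊤ : Subgroup ↥(zpowers g ⊔ commutator Q)).lowerCentralSeries (c + 1) = ⊥ := by
  have h1 := (lcs_zpowers_sup_commutator g c).trans h.le
  rw [← top_subtype_lowerCentralSeries, le_bot_iff] at h1
  exact (map_eq_bot_iff_of_injective _ (subtype_injective _)).1 h1

theorem mul_comm_of_lcs_one {Q : Type*} [Group Q]
    (h : (⊤ : Subgroup Q).lowerCentralSeries 1 = ⊥) (x y : Q) : x * y = y * x := by
  have : ⁅x, y⁆ ∈ (⊤ : Subgroup Q).lowerCentralSeries 1 :=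
    commutator_mem_commutator (mem_top x) (mem_top y)
  rw [h, mem_bot] at this
  exact commutatorElement_eq_one_iff_mul_comm.1 this

/-- In a nilpotent group the product of two elements of finite order has finite order. -/
theorem isOfFinOrder_mul_of_lcs (c : ℕ) : ∀ (Q : Type*) [Group Q],
    (⊤ : Subgroup Q).lowerCentralSeries c = ⊥ →
    ∀ x y : Q, IsOfFinOrder x → IsOfFinOrder y → IsOfFinOrder (x * y) := by
  induction c using Nat.strong_induction_on with
  | _ c ih =>
    intro Q _ hc x y hx hy
    match c, ih, hc with
    | 0, _, hc =>
      have : x * y ∈ (⊤ : Subgroup Q) := mem_top _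
      rw [← Subgroup.lowerCentralSeries_zero (⊤ : Subgroup Q), hc, mem_bot] at this
      rw [this]; exact IsOfFinOrder.one
    | 1, _, hc => exact (show Commute x y from mul_comm_of_lcs_one hc x y).isOfFinOrder_mul hx hy
    | c + 2, ih, hc =>
      let H := zpowers y ⊔ commutator Q
      have hH := lcs_zpowers_sup_commutator_eq_bot y c hc
      have hmul : ∀ a b : Q, a ∈ H → b ∈ H → IsOfFinOrder a → IsOfFinOrder b →
          IsOfFinOrder (a * b) := by
        intro a b ha hb ha' hb'
        have := ih (c + 1) (by omega) H hH ⟨a, ha⟩ ⟨b, hb⟩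
          (Submonoid.isOfFinOrder_coe.1 ha') (Submonoid.isOfFinOrder_coe.1 hb')
        exact Submonoid.isOfFinOrder_coe.2 this
      have hyH : y ∈ H := mem_sup_left (mem_zpowers y)
      have hconj : ∀ a g : Q, a ∈ H → g⁻¹ * a * g ∈ H := by
        intro a g ha
        have h1 : a * ⁅a⁻¹, g⁻¹⁆ = g⁻¹ * a * g := by
          rw [commutatorElement_def]; group
        rw [← h1]
        exact mul_mem ha (mem_sup_right (commutator_mem_commutator (mem_top _) (mem_top _)))
      have hpow : ∀ k : ℕ, ∃ b ∈ H, IsOfFinOrder b ∧ (x * y) ^ k = x ^ k * b := by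
        intro k
        induction k with
        | zero => exact ⟨1, one_mem _, IsOfFinOrder.one, by simp⟩
        | succ k ihk =>
          obtain ⟨b, hb, hb', hk⟩ := ihk
          have hfin : IsOfFinOrder (x⁻¹ * b * x) := by
            have := (MulAut.conj x⁻¹).toMonoidHom.isOfFinOrder hb'
            simpa using this
          refine ⟨x⁻¹ * b * x * y, mul_mem (hconj b x hb) hyH,
            hmul _ _ (hconj b x hb) hyH hfin hy, ?_⟩
          rw [pow_succ, hk, pow_succ]; group
      obtain ⟨n, hn, hxn⟩ := isOfFinOrder_iff_pow_eq_one.1 hx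
      obtain ⟨b, -, hb', hk⟩ := hpow n
      rw [hxn, one_mul] at hk
      rw [← hk] at hb'
      exact hb'.of_pow hn.ne'

/-- If the commutator subgroup of a group of class at most `c` has exponent dividing `M`, then
`M ^ (2 * c)`-th powers are central and multiplicative. -/
theorem pow_mul_of_commutator_exponent (M c : ℕ) : ∀ (K : Type*) [Group K],
    (⊤ : Subgroup K).lowerCentralSeries c = ⊥ → (∀ u ∈ commutator K, u ^ M = 1) →
    ∀ x y : K, x ^ M ^ (2 * c) * y = y * x ^ M ^ (2 * c) ∧
      (x * y) ^ M ^ (2 * c) = x ^ M ^ (2 * c) * y ^ M ^ (2 * c) := by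
  induction c with
  | zero =>
    intro K _ h _ x y
    have h1 : ∀ g : K, g = 1 := by
      intro g
      have : g ∈ (⊤ : Subgroup K) := mem_top _
      rwa [← Subgroup.lowerCentralSeries_zero (⊤ : Subgroup K), h, mem_bot] at this
    rw [h1 x, h1 y]; simp
  | succ c ih =>
    intro K _ h hM
    let π := QuotientGroup.mk' (center K)
    have hπ : Function.Surjective π := QuotientGroup.mk'_surjective _
    have hQ : (⊤ : Subgroup (K ⧸ center K)).lowerCentralSeries c = ⊥ := by
      rw [← map_top_of_surjective π hπ, ← map_lowerCentralSeries, eq_bot_iff, map_le_iff_le_comap]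
      intro z hz
      rw [mem_comap, mem_bot]
      refine (QuotientGroup.eq_one_iff z).2 (mem_center_iff.2 fun g => ?_)
      have : ⁅z, g⁆ ∈ (⊤ : Subgroup K).lowerCentralSeries (c + 1) :=
        commutator_mem_commutator hz (mem_top g)
      rw [h, mem_bot] at this
      exact (commutatorElement_eq_one_iff_mul_comm.1 this).symm
    have hMQ : ∀ u ∈ commutator (K ⧸ center K), u ^ M = 1 := by
      intro u hu
      rw [_root_.commutator_def, ← map_top_of_surjective π hπ, ← map_commutator] at hu
      obtain ⟨v, hv, rfl⟩ := hu
      rw [← map_pow, hM v hv, map_one]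
    have IH := ih _ hQ hMQ
    set N := M ^ (2 * c) with hN
    have hcomm : ∀ x g : K, ⁅x, g⁆ ∈ commutator K := fun x g =>
      commutator_mem_commutator (mem_top x) (mem_top g)
    have hcen : ∀ x g : K, x ^ (N * M) * g = g * x ^ (N * M) := by
      intro x g
      have hz : ⁅g, x ^ N⁆ ∈ center K := by
        refine (QuotientGroup.eq_one_iff _).1 ?_
        change π _ = 1
        rw [map_commutatorElement, commutatorElement_eq_one_iff_mul_comm, map_pow]
        exact ((IH (π x) (π g)).1).symm
      have h1 : (g * x ^ N * g⁻¹) ^ M = x ^ (N * M) := by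
        have : g * x ^ N * g⁻¹ = ⁅g, x ^ N⁆ * x ^ N := by rw [commutatorElement_def]; group
        rw [this, ((show Commute (x ^ N) ⁅g, x ^ N⁆ from mem_center_iff.1 hz _).symm).mul_pow,
          hM _ (hcomm _ _), one_mul, pow_mul]
      rw [conj_pow, ← pow_mul, mul_inv_eq_iff_eq_mul] at h1
      exact h1.symm
    have hpow : N * M * M = M ^ (2 * (c + 1)) := by rw [hN]; ring
    intro x y
    rw [← hpow]
    refine ⟨?_, ?_⟩
    · rw [pow_mul]
      exact (show Commute (x ^ (N * M)) y from hcen x y).pow_left M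
    · set ζ := (x ^ (N * M) * y ^ (N * M))⁻¹ * (x * y) ^ (N * M) with hζ
      have e1 : π ((x * y) ^ (N * M)) = π (x ^ (N * M) * y ^ (N * M)) := by
        rw [map_pow, map_mul, map_mul, map_pow, map_pow, pow_mul, (IH (π x) (π y)).2,
          (show Commute (π x ^ N) (π y ^ N) from (IH (π x) (π y ^ N)).1).mul_pow, ← pow_mul,
          ← pow_mul]
      have hz : ζ ∈ center K := by
        refine (QuotientGroup.eq_one_iff _).1 ?_
        change π _ = 1
        rw [hζ, map_mul, map_inv, e1, inv_mul_cancel]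
      have hz' : ζ ∈ commutator K := by
        refine (Abelianization.ker_of K) ▸ ?_
        rw [MonoidHom.mem_ker, hζ]
        simp only [map_mul, map_inv, map_pow, mul_pow, inv_mul_cancel]
      have e2 : (x * y) ^ (N * M) = x ^ (N * M) * y ^ (N * M) * ζ := by rw [hζ]; group
      rw [pow_mul, e2, (show Commute (x ^ (N * M) * y ^ (N * M)) ζ from
        mem_center_iff.1 hz _).mul_pow, hM ζ hz', mul_one,
        (show Commute (x ^ (N * M)) (y ^ (N * M)) from hcen x _).mul_pow, ← pow_mul, ← pow_mul]

/-- In groups of class at most `c` a product of `m ^ e`-th powers is an `m`-th power, for a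
suitable `e` that depends only on `c`. -/
theorem exists_pow_of_mem_closure_pow (c : ℕ) : ∃ e : ℕ, ∀ (Q : Type*) [Group Q] (m : ℕ),
    (⊤ : Subgroup Q).lowerCentralSeries c = ⊥ →
    ∀ w ∈ closure (Set.range fun g : Q => g ^ m ^ e), ∃ z : Q, w = z ^ m := by
  induction c using Nat.strong_induction_on with
  | _ c ih =>
    match c, ih with
    | 0, _ =>
      refine ⟨1, fun Q _ m hc w _ => ⟨1, ?_⟩⟩
      have : w ∈ (⊤ : Subgroup Q) := mem_top _
      rw [← Subgroup.lowerCentralSeries_zero (⊤ : Subgroup Q), hc, mem_bot] at this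
      simpa using this
    | 1, _ =>
      refine ⟨1, fun Q _ m hc w hw => ?_⟩
      induction hw using closure_induction with
      | mem w hw => obtain ⟨g, rfl⟩ := hw; exact ⟨g, by simp⟩
      | one => exact ⟨1, by simp⟩
      | mul a b _ _ ha hb =>
        obtain ⟨x, rfl⟩ := ha
        obtain ⟨y, rfl⟩ := hb
        exact ⟨x * y, ((show Commute x y from mul_comm_of_lcs_one hc x y).mul_pow m).symm⟩
      | inv a _ ha => obtain ⟨x, rfl⟩ := ha; exact ⟨x⁻¹, by simp⟩
    | c + 2, ih =>
      obtain ⟨e, he⟩ := ih (c + 1) (by omega)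
      refine ⟨e * (2 * (c + 2)), fun Q _ m hc w hw => ?_⟩
      set M := m ^ e with hMdef
      rw [pow_mul] at hw
      set N := M ^ (2 * (c + 2)) with hN
      let S : Set Q := {v | ∃ u ∈ commutator Q, v = u ^ M}
      let R : Subgroup Q := normalClosure S
      have hRS : R = closure S := by
        refine le_antisymm ?_ closure_le_normalClosure
        have : (closure S).Normal := by
          refine ⟨fun n hn g => ?_⟩
          have : (closure S).map (MulAut.conj g).toMonoidHom ≤ closure S := by
            rw [MonoidHom.map_closure, closure_le]
            rintro _ ⟨_, ⟨u, hu, rfl⟩, rfl⟩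
            refine subset_closure ⟨g * u * g⁻¹, ?_, by simp⟩
            exact (inferInstance : (commutator Q).Normal).conj_mem u hu g
          simpa using this (mem_map_of_mem _ hn)
        exact normalClosure_le_normal subset_closure
      let π := QuotientGroup.mk' R
      have hπ : Function.Surjective π := QuotientGroup.mk'_surjective _
      have hK : (⊤ : Subgroup (Q ⧸ R)).lowerCentralSeries (c + 2) = ⊥ := by
        rw [← map_top_of_surjective π hπ, ← map_lowerCentralSeries, hc, Subgroup.map_bot]
      have hMK : ∀ u ∈ commutator (Q ⧸ R), u ^ M = 1 := by
        intro u hu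
        rw [_root_.commutator_def, ← map_top_of_surjective π hπ, ← map_commutator] at hu
        obtain ⟨v, hv, rfl⟩ := hu
        rw [← map_pow]
        exact (QuotientGroup.eq_one_iff _).2 (subset_normalClosure ⟨v, hv, rfl⟩)
      have hhom := pow_mul_of_commutator_exponent M (c + 2) _ hK hMK
      have hk : ∃ g : Q, π w = π g ^ N := by
        induction hw using closure_induction with
        | mem w hw => obtain ⟨g, rfl⟩ := hw; exact ⟨g, map_pow π g _⟩
        | one => exact ⟨1, by simp⟩
        | mul a b _ _ ha hb =>
          obtain ⟨x, hx⟩ := ha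
          obtain ⟨y, hy⟩ := hb
          exact ⟨x * y, by rw [map_mul, map_mul, hx, hy, (hhom _ _).2]⟩
        | inv a _ ha => obtain ⟨x, hx⟩ := ha; exact ⟨x⁻¹, by rw [map_inv, map_inv, hx, inv_pow]⟩
      obtain ⟨g, hg⟩ := hk
      have hr : (g ^ N)⁻¹ * w ∈ closure S := by
        rw [← hRS]
        refine (QuotientGroup.eq_one_iff _).1 ?_
        change π _ = 1
        rw [map_mul, map_inv, hg, map_pow, inv_mul_cancel]
      let H := zpowers g ⊔ commutator Q
      have hH := lcs_zpowers_sup_commutator_eq_bot g c hc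
      let P : Subgroup H := closure (Set.range fun h : H => h ^ M)
      have hgP : g ^ N ∈ P.map H.subtype := by
        have hdvd : M ∣ N := dvd_pow_self M (by omega)
        obtain ⟨k, hk⟩ := hdvd
        refine ⟨(⟨g, mem_sup_left (mem_zpowers g)⟩ : H) ^ N, ?_, by simp⟩
        rw [hk, mul_comm M k, pow_mul]
        exact subset_closure ⟨_, rfl⟩
      have hrP : closure S ≤ P.map H.subtype := by
        rw [closure_le]
        rintro _ ⟨u, hu, rfl⟩
        exact ⟨(⟨u, mem_sup_right hu⟩ : H) ^ M, subset_closure ⟨_, rfl⟩, by simp⟩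
      have hwP : w ∈ P.map H.subtype := by
        have := mul_mem hgP (hrP hr)
        rwa [mul_inv_cancel_left] at this
      obtain ⟨w', hw', rfl⟩ := hwP
      obtain ⟨z, hz⟩ := he H m hH w' hw'
      exact ⟨z, by rw [hz]; simp⟩

/-! ### The torsion subgroup and the elements of infinite `p`-height -/

/-- The torsion subgroup of a nilpotent group, consisting of all elements of finite order. -/
def torsionSubgroup (G : Type*) [Group G] [Group.IsNilpotent G] : Subgroup G where
  carrier := {g | IsOfFinOrder g}
  one_mem' := IsOfFinOrder.one
  mul_mem' := by
    intro x y hx hy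
    obtain ⟨c, hc⟩ := Subgroup.nilpotent_iff_lowerCentralSeries.1 (inferInstance : Group.IsNilpotent G)
    exact isOfFinOrder_mul_of_lcs c G hc x y hx hy
  inv_mem' := fun h => h.inv

/-- `g` has infinite `p`-height in `G`: for all `i` and `j` there are `x ∈ G` and `y ∈ γ_j(G)` with
`x ^ (p ^ i) = g * y`. Here `γ_{j+1}(G)` is `lowerCentralSeries j`, with `γ_1(G) = G`. -/
def HasInfiniteHeight (p : ℕ) {G : Type*} [Group G] (g : G) : Prop :=
  ∀ i j : ℕ, ∃ x : G, ∃ y ∈ (⊤ : Subgroup G).lowerCentralSeries j, x ^ p ^ i = g * y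

theorem hasInfiniteHeight_iff (p : ℕ) {G : Type*} [Group G] (g : G) :
    HasInfiniteHeight p g ↔ ∀ i j : ℕ, ∃ z : G ⧸ (⊤ : Subgroup G).lowerCentralSeries j,
      z ^ p ^ i = (g : G ⧸ (⊤ : Subgroup G).lowerCentralSeries j) := by
  refine forall₂_congr fun i j => ⟨?_, ?_⟩
  · rintro ⟨x, y, hy, h⟩
    refine ⟨x, ?_⟩
    rw [← QuotientGroup.mk_pow, h]
    exact QuotientGroup.mk_mul_of_mem g hy
  · rintro ⟨z, hz⟩
    obtain ⟨x, rfl⟩ := QuotientGroup.mk_surjective z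
    rw [← QuotientGroup.mk_pow] at hz
    exact ⟨x, g⁻¹ * x ^ p ^ i, QuotientGroup.eq.1 hz.symm, by group⟩

/-- The subgroup `G(p)` of `G`, consisting of the elements of infinite `p`-height in `G`. -/
def infiniteHeightSubgroup (p : ℕ) (G : Type*) [Group G] : Subgroup G where
  carrier := {g | HasInfiniteHeight p g}
  one_mem' := fun i _ => ⟨1, 1, one_mem _, by simp⟩
  mul_mem' := by
    intro a b ha hb
    refine (hasInfiniteHeight_iff p _).2 fun i j => ?_
    obtain ⟨e, he⟩ := exists_pow_of_mem_closure_pow j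
    let π := QuotientGroup.mk' ((⊤ : Subgroup G).lowerCentralSeries j)
    have hQ : (⊤ : Subgroup (G ⧸ (⊤ : Subgroup G).lowerCentralSeries j)).lowerCentralSeries j
        = ⊥ := by
      rw [← map_top_of_surjective π (QuotientGroup.mk'_surjective _), ← map_lowerCentralSeries]
      exact QuotientGroup.map_mk'_self _
    obtain ⟨x, hx⟩ := (hasInfiniteHeight_iff p a).1 ha (i * e) j
    obtain ⟨y, hy⟩ := (hasInfiniteHeight_iff p b).1 hb (i * e) j
    rw [pow_mul] at hx hy
    obtain ⟨z, hz⟩ := he _ (p ^ i) hQ (x ^ (p ^ i) ^ e * y ^ (p ^ i) ^ e)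
      (mul_mem (subset_closure ⟨x, rfl⟩) (subset_closure ⟨y, rfl⟩))
    exact ⟨z, by rw [← hz, hx, hy, QuotientGroup.mk_mul]⟩
  inv_mem' := by
    intro a ha
    refine (hasInfiniteHeight_iff p _).2 fun i j => ?_
    obtain ⟨x, hx⟩ := (hasInfiniteHeight_iff p a).1 ha i j
    exact ⟨x⁻¹, by rw [inv_pow, hx, QuotientGroup.mk_inv]⟩

end GroupRingUnits

/-!
When `5 ≤ n` and `n ≠ 6`, the ring `ℤ[ζ_n]` has a unit of infinite order. Since
`ℤ[X] ⧸ (X ^ n - 1)` has finite index in the product of `ℤ[ζ_n]` and the complementary quotient,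
some power of this unit lifts to a nontrivial unit of the integral group ring of a cyclic group
`⟨h⟩` of order `n`, congruent to `1` modulo any prescribed `Q(h)` with `Q(ζ_n) ≠ 0`. Hence
`𝒱_ω = 1` forces `Q(ζ_n) = 0` as soon as `Q(h)` lies in all powers of the augmentation ideal.

The element `(g - 1) * (h - 1)` lies in all these powers when `g` and `h` have coprime orders; then
`g` and `h` are powers of `g * h`, whose order must therefore be `6` unless `g` or `h` is trivial.
It also does when `h ^ a = 1` and `g` has `a ^ i`-th roots for all `i`, which in a nilpotent group
is what infinite height amounts to. Taking `h = g` of prime power order bounds this order by `4`.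
Moreover the bicyclic unit `1 + (g - 1) * h * (1 + g + ⋯ + g ^ (m - 1))`, with `m` the order of
`g`, must be trivial, so that `h` normalizes `⟨g⟩` and `h ^ 2` centralizes it.
-/

namespace GroupRingUnits

section CyclotomicUnits

open Polynomial

theorem norm_geom_sum_exp_mul_abs_sin (θ : ℝ) (k : ℕ) :
    ‖∑ j ∈ Finset.range k, Complex.exp (Complex.I * θ) ^ j‖ * |Real.sin (θ / 2)| =
      |Real.sin (k * θ / 2)| := by
  have h := congrArg norm (geom_sum_mul (Complex.exp (Complex.I * θ)) k)
  rw [← Complex.exp_nat_mul, show k * (Complex.I * θ) = Complex.I * ((k * θ : ℝ) : ℂ) by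
    push_cast; ring, norm_mul, Complex.norm_exp_I_mul_ofReal_sub_one,
    Complex.norm_exp_I_mul_ofReal_sub_one] at h
  simp only [norm_mul, Real.norm_eq_abs, abs_two] at h
  linarith

theorem one_lt_norm_geom_sum_exp {n k : ℕ} (hk : 2 ≤ k) (hkn : 2 * k ≤ n) :
    1 < ‖∑ j ∈ Finset.range k, Complex.exp (2 * Real.pi * Complex.I / n) ^ j‖ := by
  have hn : (0 : ℝ) < n := by exact_mod_cast (by omega : 0 < n)
  have hk' : (2 : ℝ) ≤ k := by exact_mod_cast hk
  have hkn' : (2 * k : ℝ) ≤ n := by exact_mod_cast hkn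
  set θ : ℝ := 2 * Real.pi / n with hθ
  have hθ0 : 0 < θ := by positivity
  have hkθ : k * θ / 2 ≤ Real.pi / 2 := by
    rw [hθ, show k * (2 * Real.pi / n) / 2 = k * Real.pi / n by ring, div_le_iff₀ hn]
    nlinarith [Real.pi_pos]
  have hlt : θ / 2 < k * θ / 2 := by nlinarith
  have hsin : 0 < Real.sin (θ / 2) :=
    Real.sin_pos_of_pos_of_lt_pi (by positivity) (by linarith [Real.pi_pos])
  have hsin_lt : Real.sin (θ / 2) < Real.sin (k * θ / 2) :=
    Real.sin_lt_sin_of_lt_of_le_pi_div_two (by linarith [Real.pi_pos]) hkθ hlt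
  have h := norm_geom_sum_exp_mul_abs_sin θ k
  rw [abs_of_pos hsin, abs_of_pos (hsin.trans hsin_lt)] at h
  rw [show 2 * Real.pi * Complex.I / n = Complex.I * (θ : ℂ) by rw [hθ]; push_cast; ring]
  exact lt_of_mul_lt_mul_right (by rwa [one_mul, h]) hsin.le

theorem exists_coprime_of_five_le {n : ℕ} (hn : 5 ≤ n) (h6 : n ≠ 6) :
    ∃ k, 2 ≤ k ∧ 2 * k ≤ n ∧ k.Coprime n := by
  rcases (by omega : n % 2 = 1 ∨ n % 4 = 0 ∨ n % 4 = 2) with h | h | h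
  · exact ⟨2, le_rfl, by omega, Nat.coprime_two_left.2 (Nat.odd_iff.2 h)⟩
  · obtain ⟨m, rfl⟩ : ∃ m, n = 4 * (m + 1) := ⟨n / 4 - 1, by omega⟩
    refine ⟨2 * m + 1, by omega, by omega, ?_⟩
    rw [show 4 * (m + 1) = 2 + (2 * m + 1) * 2 by ring, Nat.coprime_add_mul_left_right,
      Nat.coprime_two_right]
    exact odd_two_mul_add_one m
  · obtain ⟨m, rfl⟩ : ∃ m, n = 4 * m + 10 := ⟨(n - 10) / 4, by omega⟩
    refine ⟨2 * m + 3, by omega, by omega, ?_⟩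
    rw [show 4 * m + 10 = 2 ^ 2 + (2 * m + 3) * 2 by ring, Nat.coprime_add_mul_left_right]
    exact Nat.Coprime.pow_right 2 (Nat.coprime_two_right.2 ⟨m + 1, by ring⟩)

theorem cyclotomic_dvd_iff_aeval_eq_zero {K : Type*} [Field K] [CharZero K] {n : ℕ} (hn : 0 < n)
    {ζ : K} (hζ : IsPrimitiveRoot ζ n) (P : ℤ[X]) : cyclotomic n ℤ ∣ P ↔ aeval ζ P = 0 := by
  rw [cyclotomic_eq_minpoly hζ hn, minpoly.isIntegrallyClosed_dvd_iff (hζ.isIntegral hn)]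

theorem cyclotomic_dvd_X_pow_sub_one_iff {n : ℕ} (hn : 0 < n) (a : ℕ) :
    cyclotomic n ℤ ∣ X ^ a - 1 ↔ n ∣ a := by
  have hζ := Complex.isPrimitiveRoot_exp n hn.ne'
  rw [cyclotomic_dvd_iff_aeval_eq_zero hn hζ, ← hζ.pow_eq_one_iff_dvd]
  simp only [map_sub, map_pow, aeval_X, map_one, sub_eq_zero]

theorem cyclotomic_mul_prod_properDivisors {n : ℕ} (hn : 0 < n) :
    cyclotomic n ℤ * ∏ d ∈ n.properDivisors, cyclotomic d ℤ = X ^ n - 1 := by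
  rw [← prod_cyclotomic_eq_X_pow_sub_one hn, ← Nat.cons_self_properDivisors hn.ne',
    Finset.prod_cons]

theorem not_cyclotomic_dvd_prod_properDivisors {n : ℕ} (hn : 0 < n) :
    ¬ cyclotomic n ℤ ∣ ∏ d ∈ n.properDivisors, cyclotomic d ℤ := by
  rw [(cyclotomic.irreducible hn).prime.dvd_finsetProd_iff]
  rintro ⟨d, hd, hdvd⟩
  have hnd := (cyclotomic_dvd_X_pow_sub_one_iff hn d).1
    (hdvd.trans (cyclotomic.dvd_X_pow_sub_one d ℤ))
  exact Nat.not_dvd_of_pos_of_lt (Nat.pos_of_mem_properDivisors hd)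
    (Nat.mem_properDivisors.1 hd).2 hnd

theorem isPrimitiveRoot_mk_X_cyclotomic {n : ℕ} (hn : 0 < n) :
    IsPrimitiveRoot (Ideal.Quotient.mk (Ideal.span {cyclotomic n ℤ}) X) n := by
  have hpow (a : ℕ) : Ideal.Quotient.mk (Ideal.span {cyclotomic n ℤ}) X ^ a = 1 ↔ n ∣ a := by
    rw [← cyclotomic_dvd_X_pow_sub_one_iff hn, ← Ideal.Quotient.eq_zero_iff_dvd, map_sub, map_pow,
      map_one, sub_eq_zero]
  exact ⟨(hpow n).2 dvd_rfl, fun a => (hpow a).1⟩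

theorem isDomain_quotient_cyclotomic {n : ℕ} (hn : 0 < n) :
    IsDomain (ℤ[X] ⧸ Ideal.span {cyclotomic n ℤ}) := by
  rw [Ideal.Quotient.isDomain_iff_prime,
    Ideal.span_singleton_prime (cyclotomic_ne_zero n ℤ)]
  exact (cyclotomic.irreducible hn).prime

theorem finite_quotient_cyclotomic_quotient {n : ℕ} (hn : 0 < n)
    {I : Ideal (ℤ[X] ⧸ Ideal.span {cyclotomic n ℤ})} (hI : I ≠ ⊥) : Finite (_ ⧸ I) := by
  have := isDomain_quotient_cyclotomic hn
  have := (cyclotomic.monic n ℤ).free_quotient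
  have := (cyclotomic.monic n ℤ).finite_quotient
  exact Ideal.finiteQuotientOfFreeOfNeBot I hI

theorem exists_unit_cyclotomic_not_isOfFinOrder {n : ℕ} (hn : 5 ≤ n) (h6 : n ≠ 6) :
    ∃ u : (ℤ[X] ⧸ Ideal.span {cyclotomic n ℤ})ˣ, ¬ IsOfFinOrder u := by
  have hn0 : 0 < n := by omega
  have := isDomain_quotient_cyclotomic hn0
  obtain ⟨k, hk, hkn, hcop⟩ := exists_coprime_of_five_le hn h6
  obtain ⟨u, hu⟩ := (isPrimitiveRoot_mk_X_cyclotomic hn0).geom_sum_isUnit (by omega) hcop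
  refine ⟨u, fun hfin => ?_⟩
  obtain ⟨N, hN, huN⟩ := isOfFinOrder_iff_pow_eq_one.1 hfin
  have hdvd : cyclotomic n ℤ ∣ (∑ j ∈ Finset.range k, X ^ j) ^ N - 1 := by
    rw [← Ideal.Quotient.eq_zero_iff_dvd, map_sub, map_pow, map_sum, map_one]
    simp only [map_pow]
    rw [← hu, ← Units.val_pow_eq_pow_val, huN, Units.val_one, sub_self]
  rw [cyclotomic_dvd_iff_aeval_eq_zero hn0 (Complex.isPrimitiveRoot_exp n hn0.ne')] at hdvd
  simp only [map_sub, map_pow, map_sum, aeval_X, map_one, sub_eq_zero] at hdvd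
  exact (one_lt_norm_geom_sum_exp hk hkn).ne' (Complex.norm_eq_one_of_pow_eq_one hdvd hN.ne')

end CyclotomicUnits

section LiftingUnits

theorem exists_pow_unit_sub_one_mem {B : Type*} [Ring B] (I : Ideal B) [I.IsTwoSided]
    [Finite (B ⧸ I)] (u : Bˣ) :
    ∃ N, 0 < N ∧ ((u ^ N : Bˣ) : B) - 1 ∈ I ∧ (((u ^ N)⁻¹ : Bˣ) : B) - 1 ∈ I := by
  obtain ⟨N, hN, huN⟩ := isOfFinOrder_iff_pow_eq_one.1
    (isOfFinOrder_of_finite (Units.map (Ideal.Quotient.mk I : B →* B ⧸ I) u))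
  rw [← map_pow] at huN
  have huN' : Units.map (Ideal.Quotient.mk I : B →* B ⧸ I) (u ^ N)⁻¹ = 1 := by
    rw [map_inv, huN, inv_one]
  refine ⟨N, hN, ?_, ?_⟩ <;> rw [← Ideal.Quotient.eq, map_one]
  · exact congrArg Units.val huN
  · exact congrArg Units.val huN'

theorem exists_unit_map_eq_pow {A B : Type*} [CommRing A] [CommRing B] {f : A →+* B}
    (hf : Function.Surjective f) {J : Ideal A} (hJ : J ⊓ RingHom.ker f = ⊥)
    [Finite (B ⧸ J.map f)] (u : Bˣ) :
    ∃ N, 0 < N ∧ ∃ v : Aˣ, (v : A) - 1 ∈ J ∧ Units.map (f : A →* B) v = u ^ N := by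
  obtain ⟨N, hN, hu, hu'⟩ := exists_pow_unit_sub_one_mem (J.map f) u
  obtain ⟨j, hj, hju⟩ := (Ideal.mem_map_iff_of_surjective f hf).1 hu
  obtain ⟨j', hj', hju'⟩ := (Ideal.mem_map_iff_of_surjective f hf).1 hu'
  have hv : f (1 + j) = ↑(u ^ N) := by rw [map_add, map_one, hju, add_sub_cancel]
  have hv' : f (1 + j') = ↑(u ^ N)⁻¹ := by rw [map_add, map_one, hju', add_sub_cancel]
  -- The lifts of `u ^ N` and of its inverse multiply to `1` modulo `J` and modulo `ker f`.
  have hmul : (1 + j) * (1 + j') - 1 ∈ J ⊓ RingHom.ker f := by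
    refine Ideal.mem_inf.2 ⟨?_, ?_⟩
    · rw [show (1 + j) * (1 + j') - 1 = j + (1 + j) * j' by ring]
      exact add_mem hj (J.mul_mem_left _ hj')
    · rw [RingHom.mem_ker, map_sub, map_mul, hv, hv', Units.mul_inv, map_one, sub_self]
  rw [hJ, Ideal.mem_bot, sub_eq_zero] at hmul
  exact ⟨N, hN, Units.mkOfMulEqOne _ _ hmul, by simpa using hj, Units.ext hv⟩

end LiftingUnits

section CyclicGroupRing

open Polynomial

theorem exists_unit_ne_one_sub_one_mem_span {n : ℕ} (hn : 5 ≤ n) (h6 : n ≠ 6) {Q : ℤ[X]}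
    (hQ : ¬ cyclotomic n ℤ ∣ Q) :
    ∃ v : (ℤ[X] ⧸ Ideal.span {(X ^ n - 1 : ℤ[X])})ˣ, v ≠ 1 ∧
      (v : ℤ[X] ⧸ Ideal.span {(X ^ n - 1 : ℤ[X])}) - 1 ∈
        Ideal.span {Ideal.Quotient.mk (Ideal.span {(X ^ n - 1 : ℤ[X])}) Q} := by
  have hn0 : 0 < n := by omega
  set Φ := cyclotomic n ℤ
  set Ψ := ∏ d ∈ n.properDivisors, cyclotomic d ℤ
  have hprime : Prime Φ := (cyclotomic.irreducible hn0).prime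
  have hΨ : ¬ Φ ∣ Ψ := not_cyclotomic_dvd_prod_properDivisors hn0
  have hΦΨ : Φ * Ψ = X ^ n - 1 := cyclotomic_mul_prod_properDivisors hn0
  have hle : Ideal.span {(X ^ n - 1 : ℤ[X])} ≤ Ideal.span {Φ} :=
    Ideal.span_singleton_le_span_singleton.2 (cyclotomic.dvd_X_pow_sub_one n ℤ)
  set f := Ideal.Quotient.factor hle
  set mk := Ideal.Quotient.mk (Ideal.span {(X ^ n - 1 : ℤ[X])})
  have hfmk (P : ℤ[X]) : f (mk P) = 0 ↔ Φ ∣ P := by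
    rw [Ideal.Quotient.factor_mk, Ideal.Quotient.eq_zero_iff_dvd]
  have hJ : Ideal.span {mk (Q * Ψ)} ⊓ RingHom.ker f = ⊥ := by
    refine eq_bot_iff.2 fun x hx => ?_
    obtain ⟨hx, hfx⟩ := Ideal.mem_inf.1 hx
    obtain ⟨y, rfl⟩ := Ideal.mem_span_singleton'.1 hx
    obtain ⟨S, rfl⟩ := Ideal.Quotient.mk_surjective y
    rw [← map_mul, RingHom.mem_ker, hfmk, hprime.dvd_mul, hprime.dvd_mul] at hfx
    obtain ⟨R, rfl⟩ : Φ ∣ S := by tauto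
    rw [Ideal.mem_bot, ← map_mul, Ideal.Quotient.eq_zero_iff_dvd, ← hΦΨ]
    exact ⟨R * Q, by ring⟩
  have : Finite (_ ⧸ (Ideal.span {mk (Q * Ψ)}).map f) := by
    refine finite_quotient_cyclotomic_quotient hn0 ?_
    rw [Ideal.map_span, Set.image_singleton, Ne, Ideal.span_singleton_eq_bot, hfmk, hprime.dvd_mul]
    tauto
  obtain ⟨u, hu⟩ := exists_unit_cyclotomic_not_isOfFinOrder hn h6
  obtain ⟨N, hN, v, hvJ, hvu⟩ :=
    exists_unit_map_eq_pow (Ideal.Quotient.factor_surjective hle) hJ u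
  refine ⟨v, ?_, ?_⟩
  · rintro rfl
    exact hu (isOfFinOrder_iff_pow_eq_one.2 ⟨N, hN, by rw [← hvu, map_one]⟩)
  · exact Ideal.span_singleton_le_span_singleton.2 (by rw [map_mul]; exact dvd_mul_right _ _) hvJ

end CyclicGroupRing

section IdealPowers

variable {R : Type*} [Ring R] {I : Ideal R} [I.IsTwoSided]

theorem pow_le_comap_pow {S : Type*} [Ring S] {f : R →+* S} {K : Ideal R} {J : Ideal S}
    (h : K ≤ J.comap f) (n : ℕ) : K ^ n ≤ (J ^ n).comap f := by
  induction n with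
  | zero => simp [Submodule.pow_zero, Ideal.one_eq_top]
  | succ n ih =>
    rw [Submodule.pow_succ, Submodule.pow_succ]
    refine Ideal.mul_le.2 fun r hr s hs => ?_
    rw [Ideal.mem_comap, map_mul]
    exact Ideal.mul_mem_mul (ih hr) (h hs)

theorem pow_sub_one_mem {x : R} (hx : x - 1 ∈ I) (n : ℕ) : x ^ n - 1 ∈ I := by
  rw [← Ideal.Quotient.eq, map_one] at hx ⊢
  rw [map_pow, hx, one_pow]

theorem geom_sum_sub_natCast_mem {x : R} (hx : x - 1 ∈ I) (a : ℕ) :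
    ∑ i ∈ Finset.range a, x ^ i - (a : R) ∈ I := by
  rw [← Ideal.Quotient.eq, map_one] at hx
  rw [← Ideal.Quotient.eq, map_sum, map_natCast]
  simp [hx]

theorem nsmul_mem_pow_succ_iff {x y : R} {n : ℕ} (hx : x - 1 ∈ I) (hy : y ∈ I ^ n) (a : ℕ) :
    a • y ∈ I ^ (n + 1) ↔ (∑ i ∈ Finset.range a, x ^ i) * y ∈ I ^ (n + 1) := by
  have hmem : (∑ i ∈ Finset.range a, x ^ i - (a : R)) * y ∈ I ^ (n + 1) := by
    rw [Ideal.IsTwoSided.pow_succ]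
    exact Ideal.mul_mem_mul (geom_sum_sub_natCast_mem hx a) hy
  rw [sub_mul, ← nsmul_eq_mul] at hmem
  exact ⟨fun h => (Submodule.sub_mem_iff_left _ h).1 hmem,
    fun h => (Submodule.sub_mem_iff_right _ h).1 hmem⟩

theorem pow_nsmul_sub_one_mem_pow_succ {x : R} {a : ℕ} (hx : x - 1 ∈ I) (hxa : x ^ a = 1) (k : ℕ) :
    a ^ k • (x - 1) ∈ I ^ (k + 1) := by
  induction k with
  | zero => simpa [Submodule.pow_one] using hx
  | succ k ih =>
    rw [pow_succ', mul_nsmul', nsmul_mem_pow_succ_iff hx ih, mul_smul_comm, geom_sum_mul, hxa,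
      sub_self, smul_zero]
    exact zero_mem _

theorem pow_nsmul_pow_pow_sub_one_mul_mem {x c : R} {a : ℕ} (hx : x - 1 ∈ I)
    (hc : ∀ k, a ^ k • c ∈ I ^ k) (m k : ℕ) : a ^ k • ((x ^ a ^ m - 1) * c) ∈ I ^ (m + k) := by
  induction m generalizing k with
  | zero =>
    rw [← mul_smul_comm, zero_add]
    exact Ideal.mul_mem_left _ _ (hc k)
  | succ m ih =>
    have hfactor : (x ^ a ^ (m + 1) - 1) * c =
        (∑ i ∈ Finset.range a, (x ^ a ^ m) ^ i) * ((x ^ a ^ m - 1) * c) := by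
      rw [← mul_assoc, geom_sum_mul, pow_succ, pow_mul]
    rw [hfactor, ← mul_smul_comm, Nat.add_right_comm,
      ← nsmul_mem_pow_succ_iff (pow_sub_one_mem hx _) (ih k), ← mul_nsmul', ← pow_succ']
    exact ih (k + 1)

theorem pow_pow_sub_one_mul_mem_pow {x c : R} {a : ℕ} (hx : x - 1 ∈ I)
    (hc : ∀ k, a ^ k • c ∈ I ^ k) (n : ℕ) : (x ^ a ^ n - 1) * c ∈ I ^ n := by
  simpa using pow_nsmul_pow_pow_sub_one_mul_mem hx hc n 0

theorem mul_mem_pow_of_coprime {c d : R} {a b : ℕ} (hab : a.Coprime b)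
    (hc : ∀ n, a ^ n • c ∈ I ^ n) (hd : ∀ n, b ^ n • d ∈ I ^ n) (n : ℕ) : c * d ∈ I ^ n := by
  obtain ⟨u, v, huv⟩ := Nat.isCoprime_iff_coprime.2 (hab.pow n n)
  have hcd : c * d = u • ((a ^ n • c) * d) + v • (c * (b ^ n • d)) := by
    rw [smul_mul_assoc, mul_smul_comm, ← natCast_zsmul, ← natCast_zsmul, smul_smul, smul_smul,
      ← add_smul, huv, one_smul]
  rw [hcd]
  exact add_mem (zsmul_mem (Ideal.mul_mem_right _ _ (hc n)) u)
    (zsmul_mem (Ideal.mul_mem_left _ _ (hd n)) v)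

end IdealPowers

section AugmentationResidue

open MonoidAlgebra (of)

instance (G : Type*) [Group G] : (augmentationIdeal G).IsTwoSided :=
  inferInstanceAs (RingHom.ker (augmentation G)).IsTwoSided

/-- The residue `Δ^ω(G) = ⋂ₙ Δⁿ(G)` of the augmentation ideal of `ℤG`, so that `𝒱_ω(ℤG)` consists
of the units lying in `1 + Δ^ω(G)`. -/
noncomputable def augmentationResidue (G : Type*) [Group G] : Ideal (MonoidAlgebra ℤ G) :=
  ⨅ n : ℕ, augmentationIdeal G ^ n

theorem mem_augmentationResidue {G : Type*} [Group G] {x : MonoidAlgebra ℤ G} :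
    x ∈ augmentationResidue G ↔ ∀ n, x ∈ augmentationIdeal G ^ n :=
  Submodule.mem_iInf _

instance (G : Type*) [Group G] : (augmentationResidue G).IsTwoSided where
  mul_mem_of_left _ ha := mem_augmentationResidue.2 fun n =>
    Ideal.mul_mem_right _ _ (mem_augmentationResidue.1 ha n)

variable {G : Type*} [Group G]

theorem mem_deltaAdicResidue_iff {u : (MonoidAlgebra ℤ G)ˣ} :
    u ∈ deltaAdicResidue G ↔ (u : MonoidAlgebra ℤ G) - 1 ∈ augmentationResidue G := by
  have hnormalized : u ∈ normalizedUnits G ↔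
      (u : MonoidAlgebra ℤ G) - 1 ∈ augmentationIdeal G := by
    rw [normalizedUnits, MonoidHom.mem_ker, Units.ext_iff, augmentationIdeal, RingHom.mem_ker,
      map_sub, map_one, sub_eq_zero]
    rfl
  rw [mem_augmentationResidue]
  simp only [deltaAdicResidue, Subgroup.mem_iInf]
  refine ⟨fun h n => Ideal.pow_le_pow_right n.le_succ (h (n + 1) n.succ_pos).2,
    fun h n _ => ⟨?_, h n⟩⟩
  rw [hnormalized, ← Submodule.pow_one (augmentationIdeal G)]
  exact h 1

theorem deltaAdicResidue_eq_bot_of_injective {H : Type*} [Group H] {f : H →* G}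
    (hf : Function.Injective f) (hG : deltaAdicResidue G = ⊥) : deltaAdicResidue H = ⊥ := by
  let F : MonoidAlgebra ℤ H →+* MonoidAlgebra ℤ G := MonoidAlgebra.mapDomainRingHom ℤ f
  have hF : Function.Injective F := MonoidAlgebra.mapDomain_injective hf
  have haug : (augmentation G : MonoidAlgebra ℤ G →+* ℤ).comp F = augmentation H := by
    ext <;> simp [F, augmentation]
  have hΔ : augmentationIdeal H ≤ (augmentationIdeal G).comap F := fun x hx => by
    rw [augmentationIdeal, RingHom.mem_ker] at hx
    rw [Ideal.mem_comap, augmentationIdeal, RingHom.mem_ker]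
    exact (RingHom.congr_fun haug x).trans hx
  refine eq_bot_iff.2 fun u hu => ?_
  have hFu : Units.map (F : MonoidAlgebra ℤ H →* MonoidAlgebra ℤ G) u ∈ deltaAdicResidue G := by
    rw [mem_deltaAdicResidue_iff, mem_augmentationResidue] at hu ⊢
    intro n
    simpa using pow_le_comap_pow hΔ n (hu n)
  rw [hG, Subgroup.mem_bot] at hFu
  exact Units.map_injective hF (hFu.trans (map_one _).symm)

theorem of_sub_one_mem_augmentationIdeal (g : G) : of ℤ G g - 1 ∈ augmentationIdeal G := by
  simp [augmentationIdeal, RingHom.mem_ker, augmentation]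

theorem pow_nsmul_of_sub_one_mem {g : G} {a : ℕ} (hg : g ^ a = 1) (k : ℕ) :
    a ^ k • (of ℤ G g - 1) ∈ augmentationIdeal G ^ k :=
  Ideal.pow_le_pow_right k.le_succ <| pow_nsmul_sub_one_mem_pow_succ
    (of_sub_one_mem_augmentationIdeal g) (by rw [← map_pow, hg, map_one]) k

theorem of_sub_one_mul_of_sub_one_mem_of_coprime {g h : G} {a b : ℕ} (hab : a.Coprime b)
    (hg : g ^ a = 1) (hh : h ^ b = 1) :
    (of ℤ G g - 1) * (of ℤ G h - 1) ∈ augmentationResidue G :=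
  mem_augmentationResidue.2 <|
    mul_mem_pow_of_coprime hab (pow_nsmul_of_sub_one_mem hg) (pow_nsmul_of_sub_one_mem hh)

/-- `g` has an `aⁿ`-th root for every `n`. For a prime `a` in a nilpotent group this is the same as
infinite `a`-height. -/
def IsInfinitelyDivisible {M : Type*} [Monoid M] (a : ℕ) (g : M) : Prop :=
  ∀ n : ℕ, ∃ x : M, x ^ a ^ n = g

theorem of_sub_one_mul_of_sub_one_mem_of_isInfinitelyDivisible {g h : G} {a : ℕ}
    (hg : IsInfinitelyDivisible a g) (hh : h ^ a = 1) :
    (of ℤ G g - 1) * (of ℤ G h - 1) ∈ augmentationResidue G := by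
  refine mem_augmentationResidue.2 fun n => ?_
  obtain ⟨x, rfl⟩ := hg n
  rw [map_pow]
  exact pow_pow_sub_one_mul_mem_pow (of_sub_one_mem_augmentationIdeal x)
    (pow_nsmul_of_sub_one_mem hh) n

end AugmentationResidue

section CoefficientComparison

open Polynomial
open MonoidAlgebra (of)

variable {R : Type*}

theorem coeff_aeval_of_pow {M : Type*} [Monoid M] [CommRing R] {h : M} {P : R[X]}
    (hP : P.natDegree < orderOf h) {j : ℕ} (hj : j < orderOf h) :
    (aeval (of R M h) P).coeff (h ^ j) = P.coeff j := by
  classical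
  conv_lhs =>
    rw [P.as_sum_range' _ hP, map_sum, MonoidAlgebra.coeff_sum, Finsupp.finsetSum_apply]
  simp only [aeval_monomial, ← map_pow, ← Algebra.smul_def]
  simp only [MonoidAlgebra.of_apply, MonoidAlgebra.coeff_smul, Finsupp.smul_apply,
    MonoidAlgebra.coeff_single, Finsupp.single_apply]
  rw [Finset.sum_eq_single j]
  · simp
  · intro i hi hij
    rw [if_neg fun hpow => hij (pow_injOn_Iio_orderOf (Finset.mem_range.1 hi) hj hpow), smul_zero]
  · exact fun hj' => absurd (Finset.mem_range.2 hj) hj'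

theorem aeval_of_eq_zero_iff {M : Type*} [Monoid M] [CommRing R] [Nontrivial R] {h : M}
    (hh : IsOfFinOrder h) {P : R[X]} : aeval (of R M h) P = 0 ↔ X ^ orderOf h - 1 ∣ P := by
  set D : R[X] := X ^ orderOf h - 1 with hD
  have hn : orderOf h ≠ 0 := hh.orderOf_pos.ne'
  have hmonic : D.Monic := by simpa using monic_X_pow_sub_C (1 : R) hn
  have hnat : D.natDegree = orderOf h := by simpa using natDegree_X_pow_sub_C (r := (1 : R))
  have hdeg : (P %ₘ D).natDegree < orderOf h :=
    hnat ▸ natDegree_modByMonic_lt P hmonic fun h1 => hn (by rw [← hnat, h1, natDegree_one])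
  have hzero : aeval (of R M h) D = 0 := by
    simp only [hD, map_sub, map_pow, aeval_X, map_one]
    rw [← map_pow, pow_orderOf_eq_one, map_one, sub_self]
  have hmod : aeval (of R M h) P = aeval (of R M h) (P %ₘ D) := by
    conv_lhs => rw [← modByMonic_add_div P D, map_add, map_mul, hzero, zero_mul, add_zero]
  rw [hmod, ← modByMonic_eq_zero_iff_dvd hmonic]
  refine ⟨fun h0 => ?_, fun h0 => by rw [h0, map_zero]⟩
  ext j
  rcases lt_or_ge j (orderOf h) with hj | hj
  · rw [← coeff_aeval_of_pow hdeg hj, h0]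
    rfl
  · exact coeff_eq_zero_of_natDegree_lt (hdeg.trans_le hj)

theorem conj_mem_zpowers_of_mul_geom_sum_eq_zero {G : Type*} [Group G] [Ring R] [CharZero R]
    {h x : G} {n : ℕ} (hn : 0 < n)
    (h0 : (of R G h - 1) * of R G x * ∑ i ∈ Finset.range n, of R G h ^ i = 0) :
    x⁻¹ * h * x ∈ Subgroup.zpowers h := by
  classical
  rw [sub_mul, sub_mul, one_mul, sub_eq_zero] at h0
  simp only [Finset.mul_sum, ← map_pow, ← map_mul] at h0
  have hcoeff := congrArg (fun z : MonoidAlgebra R G => z.coeff (h * x)) h0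
  simp only [MonoidAlgebra.coeff_sum, Finsupp.finsetSum_apply, MonoidAlgebra.of_apply,
    MonoidAlgebra.coeff_single, Finsupp.single_apply, Finset.sum_boole, Nat.cast_inj] at hcoeff
  have hpos : 0 < ((Finset.range n).filter fun i => x * h ^ i = h * x).card := by
    rw [← hcoeff, Finset.card_pos]
    exact ⟨0, by simpa using hn⟩
  obtain ⟨i, hi⟩ := Finset.card_pos.1 hpos
  refine ⟨i, ?_⟩
  rw [mul_assoc, ← (Finset.mem_filter.1 hi).2]
  simp

end CoefficientComparison

section TrivialResidue

open Polynomial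
open MonoidAlgebra (of)

variable {G : Type*} [Group G]

theorem eq_zero_of_mem_augmentationResidue (hG : deltaAdicResidue G = ⊥) {x : MonoidAlgebra ℤ G}
    (hx : x ∈ augmentationResidue G) (hunit : IsUnit (1 + x)) : x = 0 := by
  obtain ⟨u, hu⟩ := hunit
  have hmem : u ∈ deltaAdicResidue G := by
    rwa [mem_deltaAdicResidue_iff, hu, add_sub_cancel_left]
  rw [hG, Subgroup.mem_bot] at hmem
  rwa [hmem, Units.val_one, left_eq_add] at hu

theorem eq_of_of_sub_of_mem_augmentationResidue (hG : deltaAdicResidue G = ⊥) {g h : G}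
    (hgh : of ℤ G g - of ℤ G h ∈ augmentationResidue G) : g = h := by
  have hmem : of ℤ G (h⁻¹ * g) - 1 ∈ augmentationResidue G := by
    have := Ideal.mul_mem_left _ (of ℤ G h⁻¹) hgh
    rwa [mul_sub, ← map_mul, ← map_mul, inv_mul_cancel, map_one] at this
  have hzero := eq_zero_of_mem_augmentationResidue hG hmem
    (by rw [add_sub_cancel]; exact (Group.isUnit _).map (of ℤ G))
  rw [sub_eq_zero, ← map_one (of ℤ G)] at hzero
  exact (inv_mul_eq_one.1 (MonoidAlgebra.of_injective hzero)).symm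

theorem commute_of_coprime (hG : deltaAdicResidue G = ⊥) {g h : G} {a b : ℕ} (hab : a.Coprime b)
    (hg : g ^ a = 1) (hh : h ^ b = 1) : Commute g h := by
  refine eq_of_of_sub_of_mem_augmentationResidue hG ?_
  have heq : of ℤ G (g * h) - of ℤ G (h * g) =
      (of ℤ G g - 1) * (of ℤ G h - 1) - (of ℤ G h - 1) * (of ℤ G g - 1) := by
    rw [map_mul, map_mul]
    noncomm_ring
  rw [heq]
  exact sub_mem (of_sub_one_mul_of_sub_one_mem_of_coprime hab hg hh)
    (of_sub_one_mul_of_sub_one_mem_of_coprime hab.symm hh hg)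

theorem cyclotomic_dvd_of_aeval_mem (hG : deltaAdicResidue G = ⊥) {h : G} (h5 : 5 ≤ orderOf h)
    (h6 : orderOf h ≠ 6) {Q : ℤ[X]} (hQ : aeval (of ℤ G h) Q ∈ augmentationResidue G) :
    cyclotomic (orderOf h) ℤ ∣ Q := by
  by_contra hQ'
  have hfin : IsOfFinOrder h := orderOf_pos_iff.1 (by omega)
  obtain ⟨v, hv1, hvQ⟩ := exists_unit_ne_one_sub_one_mem_span h5 h6 hQ'
  obtain ⟨w, hw⟩ := Ideal.mem_span_singleton'.1 hvQ
  let φ : ℤ[X] ⧸ Ideal.span {(X ^ orderOf h - 1 : ℤ[X])} →+* MonoidAlgebra ℤ G :=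
    Ideal.Quotient.lift _ (aeval (of ℤ G h)).toRingHom fun P hP => by
      exact (aeval_of_eq_zero_iff hfin).2 (Ideal.mem_span_singleton.1 hP)
  have hφ : Function.Injective φ := RingHom.lift_injective_of_ker_le_ideal _ _ fun P hP =>
    Ideal.mem_span_singleton.2 ((aeval_of_eq_zero_iff hfin).1 hP)
  have hmem : φ (v - 1) ∈ augmentationResidue G := by
    rw [← hw, map_mul]
    exact Ideal.mul_mem_left _ _ hQ
  have hzero := eq_zero_of_mem_augmentationResidue hG hmem
    (by rw [map_sub, map_one, add_sub_cancel]; exact v.isUnit.map φ)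
  rw [map_eq_zero_iff φ hφ, sub_eq_zero, Units.val_eq_one] at hzero
  exact hv1 hzero

theorem mul_eq_six_of_coprime (hG : deltaAdicResidue G = ⊥) {g h : G}
    (hcop : (orderOf g).Coprime (orderOf h)) (hg : 1 < orderOf g) (hh : 1 < orderOf h) :
    orderOf g * orderOf h = 6 := by
  have hcomm := commute_of_coprime hG hcop (pow_orderOf_eq_one g) (pow_orderOf_eq_one h)
  have horder := hcomm.orderOf_mul_eq_mul_orderOf_of_coprime hcop
  set a := orderOf g
  set b := orderOf h
  by_contra h6
  have h5 : 5 ≤ a * b := by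
    have hne : a ≠ b := fun hab => by
      rw [hab, Nat.coprime_self] at hcop
      omega
    rcases hne.lt_or_gt with hab | hab <;> nlinarith
  have hdvd := cyclotomic_dvd_of_aeval_mem hG (h := g * h) (by rwa [horder]) (by rwa [horder])
    (Q := (X ^ b - 1) * (X ^ a - 1)) <| by
      simp only [map_mul (aeval _), map_sub, map_pow, aeval_X, map_one]
      rw [← map_pow, ← map_pow]
      exact of_sub_one_mul_of_sub_one_mem_of_coprime hcop
        (by rw [← pow_mul, mul_comm b a, ← horder, pow_orderOf_eq_one])
        (by rw [← pow_mul, ← horder, pow_orderOf_eq_one])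
  have hab0 : 0 < a * b := by omega
  rw [horder, (cyclotomic.irreducible hab0).prime.dvd_mul, cyclotomic_dvd_X_pow_sub_one_iff hab0,
    cyclotomic_dvd_X_pow_sub_one_iff hab0] at hdvd
  rcases hdvd with hdvd | hdvd
  · exact absurd (Nat.le_of_dvd (by omega) hdvd) (by nlinarith)
  · exact absurd (Nat.le_of_dvd (by omega) hdvd) (by nlinarith)

theorem orderOf_le_four_of_isInfinitelyDivisible (hG : deltaAdicResidue G = ⊥) {g : G} {a : ℕ}
    (hdiv : IsInfinitelyDivisible a g) (hg : g ^ a = 1) (h6 : orderOf g ≠ 6) : orderOf g ≤ 4 := by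
  by_contra! h5
  have hdvd := cyclotomic_dvd_of_aeval_mem hG h5 h6 (Q := (X ^ 1 - 1) * (X ^ 1 - 1)) <| by
    simpa only [map_mul (aeval _), map_sub, pow_one, aeval_X, map_one]
      using of_sub_one_mul_of_sub_one_mem_of_isInfinitelyDivisible hdiv hg
  have h0 : 0 < orderOf g := by omega
  rw [(cyclotomic.irreducible h0).prime.dvd_mul, or_self, cyclotomic_dvd_X_pow_sub_one_iff h0,
    Nat.dvd_one] at hdvd
  omega

theorem conj_mem_zpowers_of_isInfinitelyDivisible (hG : deltaAdicResidue G = ⊥) {h x : G} {a : ℕ}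
    (hdiv : IsInfinitelyDivisible a h) (hx : x ^ a = 1) (hh : IsOfFinOrder h) :
    x⁻¹ * h * x ∈ Subgroup.zpowers h := by
  refine conj_mem_zpowers_of_mul_geom_sum_eq_zero (R := ℤ) hh.orderOf_pos ?_
  set s := ∑ i ∈ Finset.range (orderOf h), of ℤ G h ^ i
  have hpow : of ℤ G h ^ orderOf h - 1 = 0 := by
    rw [← map_pow, pow_orderOf_eq_one, map_one, sub_self]
  have hs : s * (of ℤ G h - 1) = 0 := (geom_sum_mul _ _).trans hpow
  have hs' : (of ℤ G h - 1) * s = 0 := (mul_geom_sum _ _).trans hpow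
  -- `1 + b` is the bicyclic unit attached to `h` and `x`.
  set b := (of ℤ G h - 1) * of ℤ G x * s with hb
  have hsq : b * b = 0 := by
    calc b * b = (of ℤ G h - 1) * of ℤ G x * (s * (of ℤ G h - 1)) * of ℤ G x * s := by
          simp only [hb, mul_assoc]
      _ = 0 := by simp only [hs, mul_zero, zero_mul]
  have hmem : b ∈ augmentationResidue G := by
    rw [hb, show (of ℤ G h - 1) * of ℤ G x * s =
      (of ℤ G h - 1) * (of ℤ G x - 1) * s by rw [mul_sub_one, sub_mul _ _ s, hs', sub_zero]]
    exact Ideal.mul_mem_right _ _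
      (of_sub_one_mul_of_sub_one_mem_of_isInfinitelyDivisible hdiv hx)
  exact eq_zero_of_mem_augmentationResidue hG hmem
    (IsNilpotent.isUnit_one_add ⟨2, by rw [pow_two, hsq]⟩)

end TrivialResidue

section InfinitelyDivisible

variable {G : Type*} [Group G]

theorem HasInfiniteHeight.isInfinitelyDivisible [Group.IsNilpotent G] {p : ℕ} {g : G}
    (hg : HasInfiniteHeight p g) : IsInfinitelyDivisible p g := by
  intro i
  obtain ⟨c, hc⟩ :=
    Subgroup.nilpotent_iff_lowerCentralSeries.1 (inferInstance : Group.IsNilpotent G)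
  obtain ⟨x, y, hy, hxy⟩ := hg i c
  rw [hc, Subgroup.mem_bot] at hy
  exact ⟨x, by rw [hxy, hy, mul_one]⟩

theorem IsInfinitelyDivisible.pow_left {M : Type*} [Monoid M] {a : ℕ} {g : M}
    (hg : IsInfinitelyDivisible a g) (k : ℕ) : IsInfinitelyDivisible (a ^ k) g := fun n => by
  rw [← pow_mul]
  exact hg (k * n)

theorem sq_modEq_one_of_dvd_twentyFour {n i : ℕ} (hn : n ∣ 24) (hi : i.Coprime n) :
    i ^ 2 ≡ 1 [MOD n] := by
  have hsq : ∀ u : (ZMod 24)ˣ, u ^ 2 = 1 := by decide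
  obtain ⟨u, hu⟩ := ZMod.unitsMap_surjective hn (ZMod.unitOfCoprime i hi)
  have h1 : ZMod.unitOfCoprime i hi ^ 2 = 1 := by rw [← hu, ← map_pow, hsq, map_one]
  rw [← ZMod.natCast_eq_natCast_iff]
  simpa using congrArg Units.val h1

theorem commute_sq_of_conj_mem_zpowers {h x : G} (hh : orderOf h ∣ 24)
    (hx : x⁻¹ * h * x ∈ Subgroup.zpowers h) : Commute (x ^ 2) h := by
  have hpos : 0 < orderOf h := Nat.pos_of_dvd_of_pos hh (by norm_num)
  have hfin : IsOfFinOrder h := orderOf_pos_iff.1 hpos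
  obtain ⟨i, hi : h ^ i = x⁻¹ * h * x⟩ := hfin.mem_powers_iff_mem_zpowers.2 hx
  have hconj : SemiconjBy x (h ^ i) h := by
    rw [SemiconjBy, hi]
    group
  have hcop : i.Coprime (orderOf h) := by
    have horder := hconj.orderOf_eq
    rw [hfin.orderOf_pow, Nat.div_eq_self] at horder
    exact Nat.coprime_comm.1 (horder.resolve_left hpos.ne')
  have hsq : (h ^ i) ^ i = h := by
    conv_rhs => rw [← pow_one h]
    rw [← pow_mul, ← pow_two, pow_eq_pow_iff_modEq]
    exact sq_modEq_one_of_dvd_twentyFour hh hcop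
  have hcomm := hconj.mul_left (hconj.pow_right i)
  rwa [hsq, ← pow_two] at hcomm

variable {p : ℕ} {g h x : G}

theorem orderOf_le_four_of_isInfinitelyDivisible_prime (hG : deltaAdicResidue G = ⊥)
    (hp : p.Prime) (hdiv : IsInfinitelyDivisible p g) {k : ℕ} (hg : g ^ p ^ k = 1) :
    orderOf g ≤ 4 := by
  refine orderOf_le_four_of_isInfinitelyDivisible hG (hdiv.pow_left k) hg fun h6 => ?_
  have hdvd : 6 ∣ p ^ k := h6 ▸ orderOf_dvd_of_pow_eq_one hg
  have h2 := (Nat.prime_dvd_prime_iff_eq Nat.prime_two hp).1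
    (Nat.prime_two.dvd_of_dvd_pow (dvd_trans (by norm_num) hdvd))
  have h3 := (Nat.prime_dvd_prime_iff_eq Nat.prime_three hp).1
    (Nat.prime_three.dvd_of_dvd_pow (dvd_trans (by norm_num) hdvd))
  omega

theorem commute_sq_of_isInfinitelyDivisible (hG : deltaAdicResidue G = ⊥) (hp : p.Prime)
    (hdiv : IsInfinitelyDivisible p h) {k l : ℕ} (hh : h ^ p ^ k = 1) (hx : x ^ p ^ l = 1) :
    Commute (x ^ 2) h := by
  have hfin : IsOfFinOrder h := isOfFinOrder_iff_pow_eq_one.2 ⟨p ^ k, pow_pos hp.pos k, hh⟩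
  have h4 := orderOf_le_four_of_isInfinitelyDivisible_prime hG hp hdiv hh
  have h24 : orderOf h ∣ 24 :=
    (Nat.dvd_factorial hfin.orderOf_pos h4).trans (by norm_num [Nat.factorial])
  exact commute_sq_of_conj_mem_zpowers h24
    (conj_mem_zpowers_of_isInfinitelyDivisible hG (hdiv.pow_left l) hx hfin)

theorem commute_of_isInfinitelyDivisible (hG : deltaAdicResidue G = ⊥) (hp : p.Prime)
    (hgdiv : IsInfinitelyDivisible p g) (hhdiv : IsInfinitelyDivisible p h) {k l : ℕ}
    (hg : g ^ p ^ k = 1) (hh : h ^ p ^ l = 1) : Commute g h := by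
  obtain ⟨x, hx, hxk⟩ : ∃ x, x ^ 2 = g ∧ x ^ p ^ (k + 1) = 1 := by
    rcases hp.eq_two_or_odd' with rfl | hodd
    · obtain ⟨x, hx⟩ := hgdiv 1
      rw [pow_one] at hx
      exact ⟨x, hx, by rw [pow_succ', pow_mul, hx, hg]⟩
    · obtain ⟨m, hm⟩ := hodd.pow (n := k)
      refine ⟨g ^ (m + 1), ?_, ?_⟩
      · rw [← pow_mul, show (m + 1) * 2 = p ^ k + 1 by omega, pow_succ, hg, one_mul]
      · rw [pow_right_comm, pow_succ p, pow_mul, hg, one_pow, one_pow]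
  exact hx ▸ commute_sq_of_isInfinitelyDivisible hG hp hhdiv hh hxk

end InfinitelyDivisible

section TorsionGroup

variable {T : Type*} [Group T]

theorem exists_orderOf_eq_of_dvd {t : T} (ht : IsOfFinOrder t) {n : ℕ} (hn : n ∣ orderOf t) :
    ∃ s : T, orderOf s = n :=
  ⟨t ^ (orderOf t / n), orderOf_pow_orderOf_div ht.orderOf_pos.ne' hn⟩

theorem exists_prime_orderOf_of_not_isPGroup (htor : IsMulTorsion T) {p : ℕ}
    (hP : ¬IsPGroup p T) : ∃ s : T, (orderOf s).Prime ∧ orderOf s ≠ p := by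
  obtain ⟨t, ht⟩ := not_forall.1 hP
  obtain ⟨q, hq, hqt, hqp⟩ : ∃ q, q.Prime ∧ q ∣ orderOf t ∧ q ≠ p := by
    by_contra! hunique
    have hpow := Nat.eq_prime_pow_of_unique_prime_dvd (htor t).orderOf_pos.ne'
      fun {d} hd hdt => hunique d hd hdt
    exact ht ⟨_, hpow ▸ pow_orderOf_eq_one t⟩
  obtain ⟨s, rfl⟩ := exists_orderOf_eq_of_dvd (htor t) hqt
  exact ⟨s, hq, hqp⟩

theorem orderOf_dvd_six (hT : deltaAdicResidue T = ⊥) (htor : IsMulTorsion T)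
    (hP : ∀ p : ℕ, p.Prime → ¬IsPGroup p T) (t : T) : orderOf t ∣ 6 := by
  refine (Nat.dvd_iff_prime_pow_dvd_dvd _ _).2 fun p k hp hpk => ?_
  rcases eq_or_ne k 0 with rfl | hk
  · simp
  obtain ⟨x, hx⟩ := exists_orderOf_eq_of_dvd (htor t) hpk
  obtain ⟨s, hs, hsp⟩ := exists_prime_orderOf_of_not_isPGroup htor (hP p hp)
  have hcop : (orderOf x).Coprime (orderOf s) :=
    hx ▸ ((Nat.coprime_primes hp hs).2 hsp.symm).pow_left k
  rw [← hx]
  exact Dvd.intro _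
    (mul_eq_six_of_coprime hT hcop (hx ▸ Nat.one_lt_pow hk hp.one_lt) hs.one_lt)

theorem exists_orderOf_eq_two_three (hT : deltaAdicResidue T = ⊥) (htor : IsMulTorsion T)
    (hP : ∀ p : ℕ, p.Prime → ¬IsPGroup p T) :
    (∃ x : T, orderOf x = 2) ∧ ∃ y : T, orderOf y = 3 := by
  have htwo_or_three : ∀ s : T, (orderOf s).Prime → orderOf s = 2 ∨ orderOf s = 3 := by
    intro s hs
    have h6 : orderOf s ∣ 2 * 3 := orderOf_dvd_six hT htor hP s
    exact (hs.dvd_mul.1 h6).imp (Nat.prime_dvd_prime_iff_eq hs Nat.prime_two).1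
      (Nat.prime_dvd_prime_iff_eq hs Nat.prime_three).1
  obtain ⟨x, hx, hx3⟩ := exists_prime_orderOf_of_not_isPGroup htor (hP 3 Nat.prime_three)
  obtain ⟨y, hy, hy2⟩ := exists_prime_orderOf_of_not_isPGroup htor (hP 2 Nat.prime_two)
  exact ⟨⟨x, (htwo_or_three x hx).resolve_right hx3⟩,
    ⟨y, (htwo_or_three y hy).resolve_left hy2⟩⟩

theorem exponent_eq_six (hT : deltaAdicResidue T = ⊥) (htor : IsMulTorsion T)
    (hP : ∀ p : ℕ, p.Prime → ¬IsPGroup p T) : Monoid.exponent T = 6 := by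
  obtain ⟨⟨x, hx⟩, y, hy⟩ := exists_orderOf_eq_two_three hT htor hP
  refine Nat.dvd_antisymm (Monoid.exponent_dvd.2 (orderOf_dvd_six hT htor hP)) ?_
  have h23 : Nat.Coprime 2 3 := by norm_num
  exact h23.mul_dvd_of_dvd_of_dvd (hx ▸ Monoid.order_dvd_exponent x)
    (hy ▸ Monoid.order_dvd_exponent y)

theorem exists_eq_two_pow_mul_three_pow_of_dvd_six {n : ℕ} (hn : n ∣ 6) :
    ∃ a b : ℕ, n = 2 ^ a * 3 ^ b := by
  obtain ⟨x, y, hx, hy, rfl⟩ := Nat.dvd_mul.1 (show n ∣ 2 ^ 1 * 3 ^ 1 from hn)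
  obtain ⟨a, -, rfl⟩ := (Nat.dvd_prime_pow Nat.prime_two).1 hx
  obtain ⟨b, -, rfl⟩ := (Nat.dvd_prime_pow Nat.prime_three).1 hy
  exact ⟨a, b, rfl⟩

theorem eq_one_of_orderOf_le_four {t : T} (ht : IsOfFinOrder t) (h4 : orderOf t ≤ 4)
    (h23 : ∀ s : T, orderOf s ≠ 2 ∧ orderOf s ≠ 3) : t = 1 := by
  by_contra ht1
  obtain ⟨q, hq, hqt⟩ := Nat.exists_prime_and_dvd (mt orderOf_eq_one_iff.1 ht1)
  obtain ⟨s, hs⟩ := exists_orderOf_eq_of_dvd ht hqt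
  have hq4 : q ≤ 4 := (Nat.le_of_dvd ht.orderOf_pos hqt).trans h4
  have hs23 := h23 s
  have hq2 := hq.two_le
  obtain rfl : q = 4 := by omega
  norm_num at hq

end TorsionGroup

section PGroup

variable {T : Type*} [Group T] [Group.IsNilpotent T] {p : ℕ} {t : T}

theorem HasInfiniteHeight.orderOf_le_four (ht : HasInfiniteHeight p t)
    (hT : deltaAdicResidue T = ⊥) (hp : p.Prime) (hP : IsPGroup p T) : orderOf t ≤ 4 := by
  obtain ⟨k, hk⟩ := hP t
  exact orderOf_le_four_of_isInfinitelyDivisible_prime hT hp ht.isInfinitelyDivisible hk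

theorem HasInfiniteHeight.pow_pow_log_four_eq_one (ht : HasInfiniteHeight p t)
    (hT : deltaAdicResidue T = ⊥) (hp : p.Prime) (hP : IsPGroup p T) :
    t ^ p ^ Nat.log p 4 = 1 := by
  have := Fact.mk hp
  obtain ⟨j, hj⟩ := IsPGroup.iff_orderOf.1 hP t
  have h4 : p ^ j ≤ 4 := hj ▸ ht.orderOf_le_four hT hp hP
  rw [← orderOf_dvd_iff_pow_eq_one, hj]
  exact pow_dvd_pow p (Nat.le_log_of_pow_le hp.one_lt h4)

theorem infiniteHeightSubgroup_ne_top [Nontrivial T] (hT : deltaAdicResidue T = ⊥)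
    (hp : p.Prime) (hP : IsPGroup p T) : infiniteHeightSubgroup p T ≠ ⊤ := by
  intro htop
  have hall : ∀ t : T, HasInfiniteHeight p t := (Subgroup.eq_top_iff' _).1 htop
  obtain ⟨t, ht1⟩ := exists_ne (1 : T)
  obtain ⟨x, rfl⟩ := (hall t).isInfinitelyDivisible (Nat.log p 4)
  exact ht1 ((hall x).pow_pow_log_four_eq_one hT hp hP)

theorem HasInfiniteHeight.commute {s : T} (hs : HasInfiniteHeight p s)
    (ht : HasInfiniteHeight p t) (hT : deltaAdicResidue T = ⊥) (hp : p.Prime)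
    (hP : IsPGroup p T) : Commute s t := by
  obtain ⟨k, hk⟩ := hP s
  obtain ⟨l, hl⟩ := hP t
  exact commute_of_isInfinitelyDivisible hT hp hs.isInfinitelyDivisible
    ht.isInfinitelyDivisible hk hl

theorem exponent_infiniteHeightSubgroup_mem_Ioc (hT : deltaAdicResidue T = ⊥) (hp : p.Prime)
    (hP : IsPGroup p T) : Monoid.exponent (infiniteHeightSubgroup p T) ∈ Set.Ioc 0 4 := by
  have hpos : 0 < p ^ Nat.log p 4 := pow_pos hp.pos _
  have hdvd : Monoid.exponent (infiniteHeightSubgroup p T) ∣ p ^ Nat.log p 4 :=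
    Monoid.exponent_dvd_of_forall_pow_eq_one fun t =>
      Subtype.ext (HasInfiniteHeight.pow_pow_log_four_eq_one t.2 hT hp hP)
  exact ⟨Nat.pos_of_dvd_of_pos hdvd hpos,
    (Nat.le_of_dvd hpos hdvd).trans (Nat.pow_log_le_self p (by norm_num))⟩

end PGroup

end GroupRingUnits

theorem mainTheorem4_general {G : Type*} [Group G] [Group.IsNilpotent G]
    (hT : GroupRingUnits.deltaAdicResidue (GroupRingUnits.torsionSubgroup G) = ⊥) :
    (GroupRingUnits.torsionSubgroup G = ⊥ ∨
      ((∀ t : GroupRingUnits.torsionSubgroup G, ∃ a b : ℕ, orderOf t = 2 ^ a * 3 ^ b) ∧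
        Monoid.exponent (GroupRingUnits.torsionSubgroup G) = 6) ∨
      ∃ p : ℕ, p.Prime ∧ IsPGroup p (GroupRingUnits.torsionSubgroup G) ∧
        GroupRingUnits.infiniteHeightSubgroup p (GroupRingUnits.torsionSubgroup G) ≠ ⊤ ∧
        IsPGroup p
          (GroupRingUnits.infiniteHeightSubgroup p (GroupRingUnits.torsionSubgroup G)) ∧
        (∀ x ∈ GroupRingUnits.infiniteHeightSubgroup p (GroupRingUnits.torsionSubgroup G),
          ∀ y ∈ GroupRingUnits.infiniteHeightSubgroup p (GroupRingUnits.torsionSubgroup G),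
            x * y = y * x) ∧
        0 < Monoid.exponent
          (GroupRingUnits.infiniteHeightSubgroup p (GroupRingUnits.torsionSubgroup G)) ∧
        Monoid.exponent
          (GroupRingUnits.infiniteHeightSubgroup p (GroupRingUnits.torsionSubgroup G)) ≤ 4) ∧
    ((∀ t ∈ GroupRingUnits.torsionSubgroup G, orderOf t ≠ 2 ∧ orderOf t ≠ 3) →
      (∀ g : G, IsOfFinOrder g → g = 1) ∨
      ∃ p : ℕ, p.Prime ∧ IsPGroup p (GroupRingUnits.torsionSubgroup G) ∧
        ∀ t : GroupRingUnits.torsionSubgroup G,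
          GroupRingUnits.HasInfiniteHeight p t → t = 1) := by
  open GroupRingUnits in
  have htor : IsMulTorsion (torsionSubgroup G) := fun t => Submonoid.isOfFinOrder_coe.1 t.2
  by_cases hbot : torsionSubgroup G = ⊥
  · exact ⟨Or.inl hbot, fun _ => Or.inl ((Subgroup.eq_bot_iff_forall _).1 hbot)⟩
  by_cases hP : ∃ p : ℕ, p.Prime ∧ IsPGroup p (torsionSubgroup G)
  · obtain ⟨p, hp, hP⟩ := hP
    have := (Subgroup.nontrivial_iff_ne_bot _).2 hbot
    refine ⟨Or.inr (Or.inr ⟨p, hp, hP, infiniteHeightSubgroup_ne_top hT hp hP,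
      hP.to_subgroup _, fun x hx y hy => HasInfiniteHeight.commute hx hy hT hp hP,
      exponent_infiniteHeightSubgroup_mem_Ioc hT hp hP⟩), fun h23 => Or.inr ⟨p, hp, hP, ?_⟩⟩
    exact fun t ht => eq_one_of_orderOf_le_four (htor t) (ht.orderOf_le_four hT hp hP)
      fun s => Subgroup.orderOf_coe s ▸ h23 s s.2
  · replace hP : ∀ p : ℕ, p.Prime → ¬IsPGroup p (torsionSubgroup G) := by simpa using hP
    obtain ⟨⟨x, hx⟩, -⟩ := exists_orderOf_eq_two_three hT htor hP
    refine ⟨Or.inr (Or.inl ⟨fun t => ?_, exponent_eq_six hT htor hP⟩), fun h23 => ?_⟩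
    · exact exists_eq_two_pow_mul_three_pow_of_dvd_six (orderOf_dvd_six hT htor hP t)
    · exact absurd ((Subgroup.orderOf_coe x).trans hx) (h23 x x.2).1

theorem mainTheorem4 {G : Type*} [Group G] [Group.IsNilpotent G]
    (hG : GroupRingUnits.deltaAdicResidue G = ⊥) :
    (GroupRingUnits.torsionSubgroup G = ⊥ ∨
      ((∀ t : GroupRingUnits.torsionSubgroup G, ∃ a b : ℕ, orderOf t = 2 ^ a * 3 ^ b) ∧
        Monoid.exponent (GroupRingUnits.torsionSubgroup G) = 6) ∨
      ∃ p : ℕ, p.Prime ∧ IsPGroup p (GroupRingUnits.torsionSubgroup G) ∧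
        GroupRingUnits.infiniteHeightSubgroup p (GroupRingUnits.torsionSubgroup G) ≠ ⊤ ∧
        IsPGroup p
          (GroupRingUnits.infiniteHeightSubgroup p (GroupRingUnits.torsionSubgroup G)) ∧
        (∀ x ∈ GroupRingUnits.infiniteHeightSubgroup p (GroupRingUnits.torsionSubgroup G),
          ∀ y ∈ GroupRingUnits.infiniteHeightSubgroup p (GroupRingUnits.torsionSubgroup G),
            x * y = y * x) ∧
        0 < Monoid.exponent
          (GroupRingUnits.infiniteHeightSubgroup p (GroupRingUnits.torsionSubgroup G)) ∧
        Monoid.exponent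
          (GroupRingUnits.infiniteHeightSubgroup p (GroupRingUnits.torsionSubgroup G)) ≤ 4) ∧
    ((∀ t ∈ GroupRingUnits.torsionSubgroup G, orderOf t ≠ 2 ∧ orderOf t ≠ 3) →
      (∀ g : G, IsOfFinOrder g → g = 1) ∨
      ∃ p : ℕ, p.Prime ∧ IsPGroup p (GroupRingUnits.torsionSubgroup G) ∧
        ∀ t : GroupRingUnits.torsionSubgroup G,
          GroupRingUnits.HasInfiniteHeight p t → t = 1) :=
  mainTheorem4_general (GroupRingUnits.deltaAdicResidue_eq_bot_of_injective
    (GroupRingUnits.torsionSubgroup G).subtype_injective hG)
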